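/- Conventions. A point of $\mathbb R^n$ is rational if all its coordinates are rational. A rational polyhedron in $\mathbb R^n$ is a finite union of convex hulls of finite sets of rational points. For a rational point $y\in\mathbb R^n$ let $\mathrm{den}(y)$ be the least common denominator of its coordinates and $\tilde y=\mathrm{den}(y)\,(y,1)\in\mathbb Z^{n+1}$. A simplex $\mathrm{conv}(v_0,\dots,v_m)\subseteq\mathbb R^n$ with rational vertices is regular if $\{\tilde v_0,\dots,\tilde v_m\}$ is part of a basis of the free abelian group $\mathbb Z^{n+1}$. A regular complex is a finite simplicial complex in $\mathbb R^n$ all of whose simplexes are regular; its support is the union of its simplexes. A complex $\mathcal H$ is a subdivision of a complex $\mathcal K$ if they have the same support and every simplex of $\mathcal H$ is contained in a simplex of $\mathcal K$. The blow-up of $\mathcal K$ at a point $p$ of its support is obtained by replacing every simplex $T\in\mathcal K$ that contains $p$ by all simplexes $\mathrm{conv}(F\cup\{p\})$, where $F$ is a (possibly empty) face of $T$ not containing $p$. The Farey mediant of a regular $1$-simplex $\mathrm{conv}(v_0,v_1)$ is its rational point $v$ with $\tilde v=\tilde v_0+\tilde v_1$. A binary Farey blow-up of a regular complex is its blow-up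 at the Farey mediant of one of its $1$-simplexes. Proposition. Let $Q\subseteq P\subseteq[0,1]^n$ be rational polyhedra and let $\Delta$ be a regular complex with support $P$. Then there is a regular complex $\Delta^\natural$, a subdivision of $\Delta$ obtained from $\Delta$ by a finite (possibly empty) sequence of binary Farey blow-ups, such that $$Q=\bigcup\{T\in\Delta^\natural\mid T\subseteq Q\}.$$ -/

import Mathlib

namespace FareyComplex

/-- A point of `ℝⁿ` all of whose coordinates are rational. -/
def IsRationalPoint {n : ℕ} (x : Fin n → ℝ) : Prop :=
  ∀ i, ∃ q : ℚ, x i = (q : ℝ)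

/-- A rational polyhedron: a finite union of convex hulls of finite sets of rational points. -/
def IsRationalPolyhedron {n : ℕ} (P : Set (Fin n → ℝ)) : Prop :=
  ∃ 𝓕 : Finset (Finset (Fin n → ℝ)),
    (∀ s ∈ 𝓕, ∀ v ∈ s, IsRationalPoint v) ∧
    P = ⋃ s ∈ 𝓕, convexHull ℝ (s : Set (Fin n → ℝ))

/-- The least common denominator of the coordinates of a rational point. -/
noncomputable def den {n : ℕ} (y : Fin n → ℝ) : ℕ :=
  sInf {d : ℕ | 0 < d ∧ ∀ i, ∃ z : ℤ, (d : ℝ) * y i = (z : ℝ)}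

/-- The homogeneous correspondent `den(y) (y, 1) ∈ ℤⁿ⁺¹` of a rational point `y`. For rational `y`
the number `den(y) yᵢ` is an integer, so that the floor only serves to read it as one
(see `homog_castSucc`). -/
noncomputable def homog {n : ℕ} (y : Fin n → ℝ) : Fin (n + 1) → ℤ :=
  Fin.snoc (fun i => ⌊(den y : ℝ) * y i⌋) (den y : ℤ)

theorem den_spec {n : ℕ} {y : Fin n → ℝ} (hy : IsRationalPoint y) :
    0 < den y ∧ ∀ i, ∃ z : ℤ, (den y : ℝ) * y i = (z : ℝ) := by
  have hne : {d : ℕ | 0 < d ∧ ∀ i, ∃ z : ℤ, (d : ℝ) * y i = (z : ℝ)}.Nonempty := by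
    choose q hq using hy
    refine ⟨∏ i, (q i).den, Finset.prod_pos fun i _ => (q i).den_pos, fun i => ?_⟩
    obtain ⟨k, hk⟩ := Finset.dvd_prod_of_mem (fun i => (q i).den) (Finset.mem_univ i)
    refine ⟨k * (q i).num, ?_⟩
    rw [hk, hq i]
    have h : ((q i).den : ℝ) * ((q i : ℚ) : ℝ) = ((q i).num : ℝ) := by
      exact_mod_cast Rat.den_mul_eq_num (q i)
    push_cast
    rw [← h]
    ring
  exact Nat.sInf_mem hne

theorem homog_castSucc {n : ℕ} {y : Fin n → ℝ} (hy : IsRationalPoint y) (i : Fin n) :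
    ((homog y i.castSucc : ℤ) : ℝ) = (den y : ℝ) * y i := by
  obtain ⟨z, hz⟩ := (den_spec hy).2 i
  simp [homog, hz]

theorem homog_last {n : ℕ} (y : Fin n → ℝ) : homog y (Fin.last n) = (den y : ℤ) := by
  simp [homog]

/-- The simplex with vertex set `s` is regular: its vertices are rational and their homogeneous
correspondents are part of a basis of the free abelian group `ℤⁿ⁺¹`. -/
def IsRegularSimplex {n : ℕ} (s : Finset (Fin n → ℝ)) : Prop :=
  (∀ v ∈ s, IsRationalPoint v) ∧
    ∃ b : Module.Basis (Fin (n + 1)) ℤ (Fin (n + 1) → ℤ), ∀ v ∈ s, homog v ∈ Set.range b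

/-- A regular complex: a finite simplicial complex all of whose simplexes are regular. -/
def IsRegularComplex {n : ℕ} (K : Geometry.SimplicialComplex ℝ (Fin n → ℝ)) : Prop :=
  K.faces.Finite ∧ ∀ s ∈ K.faces, IsRegularSimplex s

/-- `H` is a subdivision of `K`. -/
def IsSubdivision {n : ℕ} (H K : Geometry.SimplicialComplex ℝ (Fin n → ℝ)) : Prop :=
  H.space = K.space ∧
    ∀ s ∈ H.faces, ∃ t ∈ K.faces,
      convexHull ℝ (s : Set (Fin n → ℝ)) ⊆ convexHull ℝ (t : Set (Fin n → ℝ))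

/-- `K'` is the blow-up of `K` at the point `p` of the support of `K`: every simplex `T` of `K`
that contains `p` is replaced by all the simplexes `conv(F ∪ {p})`, where `F` is a (possibly empty)
face of `T` that does not contain `p`. Simplexes are given by their vertex sets. -/
def IsBlowUp {n : ℕ} (K : Geometry.SimplicialComplex ℝ (Fin n → ℝ)) (p : Fin n → ℝ)
    (K' : Geometry.SimplicialComplex ℝ (Fin n → ℝ)) : Prop :=
  p ∈ K.space ∧
  ∀ s : Finset (Fin n → ℝ), s ∈ K'.faces ↔
    (s ∈ K.faces ∧ p ∉ convexHull ℝ (s : Set (Fin n → ℝ))) ∨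
    ∃ T ∈ K.faces, p ∈ convexHull ℝ (T : Set (Fin n → ℝ)) ∧
      ∃ F : Finset (Fin n → ℝ), F ⊆ T ∧ p ∉ convexHull ℝ (F : Set (Fin n → ℝ)) ∧
        (s : Set (Fin n → ℝ)) = insert p (F : Set (Fin n → ℝ))

/-- `v` is the Farey mediant of the `1`-simplex `conv(v₀, v₁)`: the rational point of the simplex
whose homogeneous correspondent is the sum of those of `v₀` and `v₁`. -/
def IsFareyMediant {n : ℕ} (v₀ v₁ v : Fin n → ℝ) : Prop :=
  v ∈ convexHull ℝ ({v₀, v₁} : Set (Fin n → ℝ)) ∧ IsRationalPoint v ∧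
    homog v = homog v₀ + homog v₁

/-- `K'` is a binary Farey blow-up of the regular complex `K`: the blow-up of `K` at the Farey
mediant of some `1`-simplex of `K`. -/
def IsBinaryFareyBlowUp {n : ℕ} (K K' : Geometry.SimplicialComplex ℝ (Fin n → ℝ)) : Prop :=
  IsRegularComplex K ∧
  ∃ v₀ v₁ v : Fin n → ℝ, v₀ ≠ v₁ ∧
    (∃ E ∈ K.faces, (E : Set (Fin n → ℝ)) = {v₀, v₁}) ∧
    IsFareyMediant v₀ v₁ v ∧ IsBlowUp K v K'

end FareyComplex

/-! Each polytope composing `Q` is cut out by finitely many affine forms with integer coefficients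
(`exists_forms_convexHull`). Suppose that no edge of a complex joins a positive vertex of such a
form to a negative one. Any two vertices of a simplex span an edge, so the form has constant sign on
every simplex. A point of the polytope is a strictly positive combination of the vertices of the
smallest face containing it, so every form, being nonnegative at the point, is nonnegative on that
whole face, and the face lies in the polytope (`exists_face_subset_of_coherent`). It therefore
suffices to reach sign coherence by Farey blow-ups.

Evaluated at homogeneous correspondents, a form takes integer values, and its value at a Farey
mediant is the sum of the values at the two ends. Blowing up an edge with opposite signs gives a
vertex of strictly smaller absolute value than the larger of the two, so a descent in the style of
Euclid's algorithm terminates if the edges are taken in the right order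
(`exists_fareyRefines_ssubset`, `exists_fareyRefines_coherent_of_bound`). Coherence, once achieved,
survives all later blow-ups (`exists_fareyRefines_edge`), so the forms can be treated one after
another.

That a blow-up is again a simplicial complex is checked through uniqueness of barycentric weights
(`hasUniqueWeights_stellarFaces`); that it is regular, by replacing one basis vector by its sum with
another (`exists_basis_mediant`). -/

namespace FareyComplex

/-! ### Finitely generated cones are cut out by finitely many integral linear forms -/

/-- The cone generated by finitely many integral vectors is the solution set of finitely many
homogeneous linear inequalities with integer coefficients. -/
theorem exists_forms_cone {ι : Type*} [DecidableEq ι] {N : ℕ} (g : ι → Fin N → ℤ) (S : Finset ι) :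
    ∃ A : Set (Fin N → ℤ), A.Finite ∧ ∀ y : Fin N → ℝ,
      (∃ c : ι → ℝ, (∀ i ∈ S, 0 ≤ c i) ∧ ∀ k, y k = ∑ i ∈ S, c i * (g i k : ℝ)) ↔
        ∀ a ∈ A, 0 ≤ ∑ k, (a k : ℝ) * y k := by
  induction S using Finset.induction_on with
  | empty =>
    -- The empty cone is the origin, cut out by the coordinates and their negatives.
    refine ⟨Set.range (fun k => Pi.single k 1) ∪ Set.range (fun k => -Pi.single k 1),
      (Set.finite_range _).union (Set.finite_range _), fun y => ?_⟩
    constructor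
    · rintro ⟨c, -, hy⟩ a -
      simp [hy]
    · intro h
      refine ⟨0, by simp, fun k => ?_⟩
      have h1 := h _ (Or.inl ⟨k, rfl⟩)
      have h2 := h _ (Or.inr ⟨k, rfl⟩)
      simp [Pi.single_apply] at h1 h2
      simp
      linarith
  | insert j S hj ih =>
    obtain ⟨A, hA, hcone⟩ := ih
    let e : (Fin N → ℤ) → ℤ := fun a => ∑ k, a k * g j k
    have hlin : ∀ (a b : Fin N → ℤ) (p q : ℤ) (y : Fin N → ℝ),
        ∑ k, (((p • a + q • b) k : ℤ) : ℝ) * y k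
          = p * ∑ k, (a k : ℝ) * y k + q * ∑ k, (b k : ℝ) * y k := by
      intro a b p q y
      rw [Finset.mul_sum, Finset.mul_sum, ← Finset.sum_add_distrib]
      refine Finset.sum_congr rfl fun k _ => ?_
      simp
      ring
    have hshift : ∀ (a : Fin N → ℤ) (y : Fin N → ℝ) (t : ℝ),
        ∑ k, (a k : ℝ) * (y k - t * g j k) = ∑ k, (a k : ℝ) * y k - t * e a := by
      intro a y t
      simp only [e]
      push_cast
      rw [Finset.mul_sum, ← Finset.sum_sub_distrib]
      exact Finset.sum_congr rfl fun k _ => by ring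
    -- The coefficient `t` of the new generator is the only unknown left: `y - t • g j` must lie in
    -- the old cone. It is then removed by Fourier–Motzkin elimination.
    have hstep : ∀ y : Fin N → ℝ,
        (∃ c : ι → ℝ, (∀ i ∈ insert j S, 0 ≤ c i) ∧
          ∀ k, y k = ∑ i ∈ insert j S, c i * (g i k : ℝ)) ↔
        ∃ t : ℝ, 0 ≤ t ∧ ∀ a ∈ A, t * e a ≤ ∑ k, (a k : ℝ) * y k := by
      intro y
      have : ∀ t, (∀ a ∈ A, t * e a ≤ ∑ k, (a k : ℝ) * y k) ↔
          ∀ a ∈ A, 0 ≤ ∑ k, (a k : ℝ) * (y k - t * g j k) := by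
        intro t
        refine forall₂_congr fun a _ => ?_
        rw [hshift, sub_nonneg]
      simp only [this]
      simp only [← hcone]
      constructor
      · rintro ⟨c, hc, hy⟩
        refine ⟨c j, hc j (by simp), c, fun i hi => hc i (by simp [hi]), fun k => ?_⟩
        rw [hy k, Finset.sum_insert hj]
        ring
      · rintro ⟨t, ht, c, hc, hy⟩
        refine ⟨Function.update c j t, ?_, fun k => ?_⟩
        · intro i hi
          by_cases hij : i = j
          · subst hij; simpa using ht
          · simpa [hij] using hc i (by simpa [hij] using hi)
        · rw [Finset.sum_insert hj, Function.update_self]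
          have : ∑ i ∈ S, Function.update c j t i * (g i k : ℝ) = ∑ i ∈ S, c i * (g i k : ℝ) := by
            refine Finset.sum_congr rfl fun i hi => ?_
            rw [Function.update_of_ne]
            rintro rfl
            exact hj hi
          rw [this, ← hy k]
          ring
    -- Forms nonnegative at `g j` bound `t` from above or not at all and are kept. Each pair with
    -- opposite signs at `g j` contributes the positive combination vanishing there, which says that
    -- its lower bound for `t` does not exceed its upper bound.
    refine ⟨{a ∈ A | 0 ≤ e a} ∪
      (fun p : (Fin N → ℤ) × (Fin N → ℤ) => e p.1 • p.2 + (-e p.2) • p.1) ''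
        ({a ∈ A | 0 < e a} ×ˢ {a ∈ A | e a < 0}),
      (hA.subset (Set.sep_subset _ _)).union
        (((hA.subset (Set.sep_subset _ _)).prod (hA.subset (Set.sep_subset _ _))).image _),
      fun y => ?_⟩
    rw [hstep]
    constructor
    · rintro ⟨t, ht, h⟩ a (⟨ha, hea⟩ | ⟨⟨p, q⟩, ⟨⟨hp, hep⟩, hq, heq⟩, rfl⟩)
      · exact le_trans (mul_nonneg ht (by exact_mod_cast hea)) (h a ha)
      · simp only at hep heq ⊢
        rw [hlin]
        have hep' : (0 : ℝ) < e p := by exact_mod_cast hep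
        have heq' : (e q : ℝ) < 0 := by exact_mod_cast heq
        push_cast
        nlinarith [h p hp, h q hq]
    · intro h
      have hpos : ∀ a ∈ A, 0 ≤ e a → 0 ≤ ∑ k, (a k : ℝ) * y k := fun a ha hea =>
        h a (Or.inl ⟨ha, hea⟩)
      -- the lower bounds for `t`: zero, and those that come from the forms negative at `g j`
      let B : Finset ℝ := insert 0 ((hA.toFinset.filter fun a => e a < 0).image
        fun a => (∑ k, (a k : ℝ) * y k) / e a)
      have hB : B.Nonempty := ⟨0, by simp [B]⟩
      refine ⟨B.max' hB, B.le_max' 0 (by simp [B]), fun a ha => ?_⟩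
      rcases lt_trichotomy (e a) 0 with hneg | hzero | hgt
      · have hneg' : (e a : ℝ) < 0 := by exact_mod_cast hneg
        have hle : (∑ k, (a k : ℝ) * y k) / e a ≤ B.max' hB := by
          refine B.le_max' _ ?_
          simp only [B, Finset.mem_insert, Finset.mem_image, Finset.mem_filter,
            Set.Finite.mem_toFinset]
          exact Or.inr ⟨a, ⟨ha, hneg⟩, rfl⟩
        rwa [div_le_iff_of_neg hneg'] at hle
      · simpa [hzero] using hpos a ha hzero.ge
      · have hgt' : (0 : ℝ) < e a := by exact_mod_cast hgt
        rw [← le_div_iff₀ hgt']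
        refine Finset.max'_le _ _ _ fun b hb => ?_
        simp only [B, Finset.mem_insert, Finset.mem_image, Finset.mem_filter,
          Set.Finite.mem_toFinset] at hb
        rcases hb with rfl | ⟨q, ⟨hq, heq⟩, rfl⟩
        · exact div_nonneg (hpos a ha hgt.le) hgt'.le
        · have heq' : (e q : ℝ) < 0 := by exact_mod_cast heq
          have := h _ (Or.inr ⟨(a, q), ⟨⟨ha, hgt⟩, hq, heq⟩, rfl⟩)
          simp only at this
          rw [hlin] at this
          push_cast at this
          rw [div_le_iff_of_neg heq', div_mul_eq_mul_div, div_le_iff₀ hgt']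
          nlinarith

/-! ### Affine forms, their homogenizations, and inequalities for rational polytopes -/

/-- The value at `x` of the affine form with coefficients `a`, the last one being the constant. -/
noncomputable def affineForm {n : ℕ} (a : Fin (n + 1) → ℤ) (x : Fin n → ℝ) : ℝ :=
  ∑ i : Fin n, (a i.castSucc : ℝ) * x i + a (Fin.last n)

/-- The value of the linear form with coefficients `a` at the homogeneous correspondent of `v`. -/
noncomputable def homogForm {n : ℕ} (a : Fin (n + 1) → ℤ) (v : Fin n → ℝ) : ℤ :=
  ∑ k, a k * homog v k

theorem den_pos {n : ℕ} {v : Fin n → ℝ} (hv : IsRationalPoint v) : (0 : ℝ) < den v := by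
  exact_mod_cast (den_spec hv).1

/-- Since denominators are positive, the two forms have the same sign at a rational point: the
integer one serves the descent, the real one serves membership in a polytope. -/
theorem homogForm_eq {n : ℕ} (a : Fin (n + 1) → ℤ) {v : Fin n → ℝ} (hv : IsRationalPoint v) :
    (homogForm a v : ℝ) = den v * affineForm a v := by
  simp only [homogForm, affineForm]
  push_cast
  rw [Fin.sum_univ_castSucc, homog_last, mul_add, Finset.mul_sum]
  congr 1
  · refine Finset.sum_congr rfl fun i _ => ?_
    rw [homog_castSucc hv]
    ring
  · push_cast
    ring

theorem affineForm_sum {n : ℕ} (a : Fin (n + 1) → ℤ) (s : Finset (Fin n → ℝ))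
    (w : (Fin n → ℝ) → ℝ) (hw : ∑ v ∈ s, w v = 1) :
    affineForm a (∑ v ∈ s, w v • v) = ∑ v ∈ s, w v * affineForm a v := by
  simp only [affineForm, mul_add, Finset.sum_add_distrib, ← Finset.sum_mul, hw, one_mul,
    Finset.sum_apply, Pi.smul_apply, smul_eq_mul, Finset.mul_sum]
  rw [Finset.sum_comm]
  congr 1
  exact Finset.sum_congr rfl fun _ _ => Finset.sum_congr rfl fun _ _ => by ring

/-- A rational polytope is the solution set of finitely many affine inequalities with integer
coefficients. -/
theorem exists_forms_convexHull {n : ℕ} (S : Finset (Fin n → ℝ)) (hS : ∀ v ∈ S, IsRationalPoint v) :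
    ∃ A : Set (Fin (n + 1) → ℤ), A.Finite ∧ ∀ x : Fin n → ℝ,
      x ∈ convexHull ℝ (S : Set (Fin n → ℝ)) ↔ ∀ a ∈ A, 0 ≤ affineForm a x := by
  obtain ⟨A, hA, h⟩ := exists_forms_cone (homog (n := n)) S
  refine ⟨A, hA, fun x => ?_⟩
  -- The polytope is the slice at height `1` of the cone over its homogenized vertices; convex
  -- weights and cone coefficients differ by the factor `den v`.
  have key := h (Fin.snoc x 1)
  have hform : ∀ a : Fin (n + 1) → ℤ,
      ∑ k, (a k : ℝ) * (Fin.snoc x 1 : Fin (n + 1) → ℝ) k = affineForm a x := by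
    intro a
    simp [Fin.sum_univ_castSucc, affineForm]
  simp only [hform] at key
  rw [← key, Finset.mem_convexHull']
  constructor
  · rintro ⟨w, hw, hsum, rfl⟩
    refine ⟨fun v => w v / den v, fun v hv => div_nonneg (hw v hv) (den_pos (hS v hv)).le,
      fun k => ?_⟩
    induction k using Fin.lastCases with
    | last =>
      simp only [Fin.snoc_last, homog_last]
      rw [← hsum]
      refine Finset.sum_congr rfl fun v hv => ?_
      have := (den_pos (hS v hv)).ne'
      push_cast
      field_simp
    | cast i =>
      simp only [Fin.snoc_castSucc, Finset.sum_apply, Pi.smul_apply, smul_eq_mul]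
      refine Finset.sum_congr rfl fun v hv => ?_
      have := (den_pos (hS v hv)).ne'
      rw [homog_castSucc (hS v hv)]
      field_simp
  · rintro ⟨c, hc, hx⟩
    refine ⟨fun v => c v * den v, fun v hv => mul_nonneg (hc v hv) (den_pos (hS v hv)).le, ?_, ?_⟩
    · have := hx (Fin.last n)
      simp only [Fin.snoc_last, homog_last] at this
      rw [this]
      push_cast
      rfl
    · ext i
      have := hx i.castSucc
      simp only [Fin.snoc_castSucc] at this
      rw [this]
      simp only [Finset.sum_apply, Pi.smul_apply, smul_eq_mul]
      refine Finset.sum_congr rfl fun v hv => ?_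
      rw [homog_castSucc (hS v hv)]
      ring

/-! ### Simplicial complexes through barycentric weights -/

section Weights

variable {E : Type*}

/-- The total mass of a system of weights. -/
noncomputable def mass : (E →₀ ℝ) →ₗ[ℝ] ℝ := Finsupp.linearCombination ℝ fun _ => (1 : ℝ)

@[simp] theorem mass_single (v : E) (c : ℝ) : mass (Finsupp.single v c) = c := by simp [mass]

theorem mass_eq_sum {w : E →₀ ℝ} {s : Finset E} (h : w.support ⊆ s) : mass w = ∑ v ∈ s, w v := by
  rw [mass, Finsupp.linearCombination_apply, Finsupp.sum_of_support_subset _ h _ (by simp)]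
  simp

theorem eq_zero_of_mass_eq_zero {w : E →₀ ℝ} (hw : 0 ≤ w) (h : mass w = 0) : w = 0 := by
  rw [mass_eq_sum subset_rfl, Finset.sum_eq_zero_iff_of_nonneg fun v _ => hw v] at h
  ext v
  by_contra hv
  exact hv (h v (Finsupp.mem_support_iff.2 hv))

theorem mass_nonneg {w : E →₀ ℝ} (hw : 0 ≤ w) : 0 ≤ mass w := by
  rw [mass_eq_sum subset_rfl]
  exact Finset.sum_nonneg fun v _ => hw v

variable [AddCommGroup E] [Module ℝ E]

/-- The sum of the points of a system of weights, each scaled by its weight. -/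
noncomputable def moment : (E →₀ ℝ) →ₗ[ℝ] E := Finsupp.linearCombination ℝ (id : E → E)

@[simp] theorem moment_single (v : E) (c : ℝ) : moment (Finsupp.single v c) = c • v := by
  simp [moment]

theorem moment_eq_sum {w : E →₀ ℝ} {s : Finset E} (h : w.support ⊆ s) :
    moment w = ∑ v ∈ s, w v • v := by
  rw [moment, Finsupp.linearCombination_apply, Finsupp.sum_of_support_subset _ h _ (by simp)]
  simp

theorem mem_convexHull_iff_weights {s : Finset E} {x : E} :
    x ∈ convexHull ℝ (s : Set E) ↔
      ∃ w : E →₀ ℝ, 0 ≤ w ∧ w.support ⊆ s ∧ mass w = 1 ∧ moment w = x := by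
  classical
  rw [Finset.mem_convexHull']
  constructor
  · rintro ⟨w, hw, hsum, hx⟩
    have hsupp : (Finsupp.onFinset s (fun v => if v ∈ s then w v else 0)
        (by intro v; simp; tauto)).support ⊆ s := Finsupp.support_onFinset_subset
    refine ⟨_, ?_, hsupp, ?_, ?_⟩
    · intro v
      simp only [Finsupp.coe_zero, Pi.zero_apply, Finsupp.onFinset_apply]
      split_ifs with hv
      · exact hw v hv
      · exact le_rfl
    · rw [mass_eq_sum hsupp, ← hsum]
      exact Finset.sum_congr rfl fun v hv => by simp [hv]
    · rw [moment_eq_sum hsupp, ← hx]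
      exact Finset.sum_congr rfl fun v hv => by simp [hv]
  · rintro ⟨w, hw, hs, hm, hx⟩
    exact ⟨w, fun v _ => hw v, by rw [← hm, mass_eq_sum hs], by rw [← hx, moment_eq_sum hs]⟩

theorem eq_of_affineIndependent {s : Finset E} (hs : AffineIndependent ℝ ((↑) : s → E))
    {w w' : E →₀ ℝ} (hw : w.support ⊆ s) (hw' : w'.support ⊆ s) (hmass : mass w = mass w')
    (hmom : moment w = moment w') : w = w' := by
  classical
  rw [mass_eq_sum hw, mass_eq_sum hw', ← sub_eq_zero, ← Finset.sum_sub_distrib] at hmass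
  rw [moment_eq_sum hw, moment_eq_sum hw', ← sub_eq_zero, ← Finset.sum_sub_distrib] at hmom
  have := hs.eq_zero_of_sum_eq_zero_subtype (w := fun v => w v - w' v) hmass
    (by simpa [sub_smul] using hmom)
  ext v
  by_cases hv : v ∈ s
  · exact sub_eq_zero.1 (this v hv)
  · rw [Finsupp.notMem_support_iff.1 fun h => hv (hw h),
      Finsupp.notMem_support_iff.1 fun h => hv (hw' h)]

/-- Nonnegative weights carried by a member of the family are determined by their mass and
moment. -/
def HasUniqueWeights (𝓕 : Set (Finset E)) : Prop :=
  ∀ s ∈ 𝓕, ∀ t ∈ 𝓕, ∀ w w' : E →₀ ℝ, 0 ≤ w → 0 ≤ w' → w.support ⊆ s → w'.support ⊆ t →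
    mass w = mass w' → moment w = moment w' → w = w'

/-- After normalization to mass `1`, the common moment lies in the hull of `s ∩ t`. Its weights
there agree with `w` by affine independence of `s`, and with `w'` by that of `t`. -/
theorem hasUniqueWeights_faces (K : Geometry.SimplicialComplex ℝ E) :
    HasUniqueWeights K.faces := by
  classical
  intro s hs t ht w w' hw hw' hws hwt hmass hmom
  rcases (mass_nonneg hw).eq_or_lt with h0 | hpos
  · rw [eq_zero_of_mass_eq_zero hw h0.symm, eq_zero_of_mass_eq_zero hw' (hmass ▸ h0.symm)]
  set c := mass w with hc
  have hc' : (0 : ℝ) ≤ c⁻¹ := inv_nonneg.2 hpos.le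
  have hsc : (c⁻¹ • w).support ⊆ s := Finsupp.support_smul.trans hws
  have htc : (c⁻¹ • w').support ⊆ t := Finsupp.support_smul.trans hwt
  have hm : mass (c⁻¹ • w) = 1 := by rw [map_smul, ← hc, smul_eq_mul, inv_mul_cancel₀ hpos.ne']
  have hm' : mass (c⁻¹ • w') = 1 := by
    rw [map_smul, ← hmass, smul_eq_mul, inv_mul_cancel₀ hpos.ne']
  have hx : moment (c⁻¹ • w) ∈ convexHull ℝ (s : Set E) :=
    mem_convexHull_iff_weights.2 ⟨_, smul_nonneg hc' hw, hsc, hm, rfl⟩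
  have hx' : moment (c⁻¹ • w) ∈ convexHull ℝ (t : Set E) :=
    mem_convexHull_iff_weights.2 ⟨_, smul_nonneg hc' hw', htc, hm', by
      rw [map_smul, map_smul, hmom]⟩
  have hst := K.inter_subset_convexHull hs ht ⟨hx, hx'⟩
  rw [← Finset.coe_inter] at hst
  obtain ⟨u, -, hust, humass, humom⟩ := mem_convexHull_iff_weights.1 hst
  have h1 : c⁻¹ • w = u := eq_of_affineIndependent (K.indep hs) hsc
    (hust.trans Finset.inter_subset_left) (hm.trans humass.symm) humom.symm
  have h2 : c⁻¹ • w' = u := eq_of_affineIndependent (K.indep ht) htc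
    (hust.trans Finset.inter_subset_right) (hm'.trans humass.symm) (by
      rw [humom, map_smul, map_smul, hmom])
  exact smul_right_injective _ (inv_ne_zero hpos.ne') (h1.trans h2.symm)

/-- The positive and negative parts of an affine dependence are nonnegative weights on `s` with the
same mass and moment, hence equal. With `HasUniqueWeights.inter_subset` this gives two axioms of a
simplicial complex from one property. -/
theorem HasUniqueWeights.affineIndependent {𝓕 : Set (Finset E)} (h : HasUniqueWeights 𝓕)
    {s : Finset E} (hs : s ∈ 𝓕) : AffineIndependent ℝ ((↑) : s → E) := by
  classical
  rw [affineIndependent_iff]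
  intro S w hsum hmom
  let p : E →₀ ℝ := ∑ v ∈ S, Finsupp.single (v : E) (w v)⁺
  let q : E →₀ ℝ := ∑ v ∈ S, Finsupp.single (v : E) (w v)⁻
  have hsupp : ∀ f : s → ℝ, (∑ v ∈ S, Finsupp.single (v : E) (f v)).support ⊆ s := by
    intro f x hx
    have := Finsupp.support_finsetSum hx
    simp only [Finset.mem_biUnion] at this
    obtain ⟨v, -, hv⟩ := this
    have := Finsupp.support_single_subset hv
    simp only [Finset.mem_singleton] at this
    exact this ▸ v.2
  have happly : ∀ f : s → ℝ, ∀ v ∈ S, (∑ v ∈ S, Finsupp.single (v : E) (f v)) v = f v := by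
    intro f v hv
    rw [Finsupp.finsetSum_apply, Finset.sum_eq_single v]
    · simp
    · intro b _ hb
      exact Finsupp.single_eq_of_ne fun h => hb (Subtype.ext h.symm)
    · exact fun h => (h hv).elim
  have hdiff : ∀ v, (w v)⁺ = w v + (w v)⁻ := fun v => by
    rw [← sub_eq_iff_eq_add, posPart_sub_negPart]
  have hpq : p = q := by
    refine h s hs s hs p q (Finset.sum_nonneg fun v _ => ?_) (Finset.sum_nonneg fun v _ => ?_)
      (hsupp _) (hsupp _) ?_ ?_
    · exact Finsupp.single_nonneg.2 (posPart_nonneg _)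
    · exact Finsupp.single_nonneg.2 (negPart_nonneg _)
    · simp only [p, q, map_sum, mass_single, hdiff, Finset.sum_add_distrib, hsum, zero_add]
    · simp only [p, q, map_sum, moment_single, hdiff, add_smul, Finset.sum_add_distrib, hmom,
        zero_add]
  intro v hv
  have : p v = q v := by rw [hpq]
  simp only [p, q] at this
  rw [happly (fun v => (w v)⁺) v hv, happly (fun v => (w v)⁻) v hv] at this
  rw [← posPart_sub_negPart (w v), this, sub_self]

theorem HasUniqueWeights.inter_subset {𝓕 : Set (Finset E)} (h : HasUniqueWeights 𝓕)
    {s t : Finset E} (hs : s ∈ 𝓕) (ht : t ∈ 𝓕) :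
    convexHull ℝ (s : Set E) ∩ convexHull ℝ (t : Set E) ⊆ convexHull ℝ (s ∩ t : Set E) := by
  classical
  rintro x ⟨hxs, hxt⟩
  obtain ⟨w, hw, hws, hwm, rfl⟩ := mem_convexHull_iff_weights.1 hxs
  obtain ⟨w', hw', hwt, hwm', hmom⟩ := mem_convexHull_iff_weights.1 hxt
  obtain rfl := h s hs t ht w w' hw hw' hws hwt (hwm.trans hwm'.symm) hmom.symm
  rw [← Finset.coe_inter]
  exact mem_convexHull_iff_weights.2 ⟨w, hw, Finset.subset_inter hws hwt, hwm, rfl⟩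

end Weights

/-! ### Stellar subdivision of an edge -/

section Stellar

variable {E : Type*} {v₀ v₁ m : E} {l₀ l₁ : ℝ}

/-- The weights obtained by distributing the weight at `m` to `v₀` and `v₁`. -/
noncomputable def distribute (v₀ v₁ m : E) (l₀ l₁ : ℝ) (w : E →₀ ℝ) : E →₀ ℝ :=
  w - Finsupp.single m (w m) + (Finsupp.single v₀ (l₀ * w m) + Finsupp.single v₁ (l₁ * w m))

theorem mass_distribute (hl : l₀ + l₁ = 1) (w : E →₀ ℝ) :
    mass (distribute v₀ v₁ m l₀ l₁ w) = mass w := by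
  simp only [distribute, map_add, map_sub, mass_single]
  linear_combination w m * hl

theorem moment_distribute [AddCommGroup E] [Module ℝ E] (hm : m = l₀ • v₀ + l₁ • v₁) (w : E →₀ ℝ) :
    moment (distribute v₀ v₁ m l₀ l₁ w) = moment w := by
  simp only [distribute, map_add, map_sub, moment_single]
  rw [mul_comm l₀, mul_comm l₁, mul_smul, mul_smul, ← smul_add, ← hm]
  abel

variable [DecidableEq E]

/-- The vertices of the original complex that span the vertices in `s`, when `m` is a new vertex
inside the edge from `v₀` to `v₁`. -/
def carrier (v₀ v₁ m : E) (s : Finset E) : Finset E :=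
  if m ∈ s then s.erase m ∪ {v₀, v₁} else s

theorem carrier_mono {v₀ v₁ m : E} {s t : Finset E} (h : s ⊆ t) :
    carrier v₀ v₁ m s ⊆ carrier v₀ v₁ m t := by
  unfold carrier
  grind

theorem carrier_nonempty {v₀ v₁ m : E} {s : Finset E} (h : s.Nonempty) :
    (carrier v₀ v₁ m s).Nonempty := by
  unfold carrier
  split_ifs
  · exact ⟨v₀, by simp⟩
  · exact h

theorem distribute_nonneg (hl₀ : 0 ≤ l₀) (hl₁ : 0 ≤ l₁) {w : E →₀ ℝ} (hw : 0 ≤ w) :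
    0 ≤ distribute v₀ v₁ m l₀ l₁ w := by
  have hwm : 0 ≤ w m := hw m
  refine add_nonneg ?_ (add_nonneg ?_ ?_)
  · intro v
    by_cases h : v = m
    · subst h; simp
    · simpa [Finsupp.single_apply, Ne.symm h] using hw v
  · exact Finsupp.single_nonneg.2 (mul_nonneg hl₀ hwm)
  · exact Finsupp.single_nonneg.2 (mul_nonneg hl₁ hwm)

theorem support_distribute_subset {w : E →₀ ℝ} {s : Finset E} (hw : w.support ⊆ s) :
    (distribute v₀ v₁ m l₀ l₁ w).support ⊆ carrier v₀ v₁ m s := by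
  intro v hv
  rw [Finsupp.mem_support_iff] at hv
  by_contra hcon
  apply hv
  have hws : v ∉ s → w v = 0 := fun h => Finsupp.notMem_support_iff.1 fun h' => h (hw h')
  have hms : m ∉ s → w m = 0 := fun h => Finsupp.notMem_support_iff.1 fun h' => h (hw h')
  unfold carrier at hcon
  simp only [distribute, Finsupp.add_apply, Finsupp.sub_apply, Finsupp.single_apply]
  split_ifs at hcon with h
  · simp only [Finset.mem_union, Finset.mem_erase, Finset.mem_insert, Finset.mem_singleton,
      not_or, not_and] at hcon
    rw [if_neg (Ne.symm hcon.2.1), if_neg (Ne.symm hcon.2.2)]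
    by_cases hvm : m = v
    · simp [hvm]
    · have : v ∉ s := fun h' => (by tauto : ¬ ¬ m = v) (by
        intro; exact hvm (by_contra fun hne => hcon.1 (Ne.symm hne) h'))
      simp [hvm, hws this]
  · simp [hws hcon, hms h]

theorem not_both_mem {s : Finset E} (hs : ¬ {v₀, v₁} ⊆ s) {w : E →₀ ℝ} (hw : w.support ⊆ s) :
    w v₀ = 0 ∨ w v₁ = 0 := by
  by_contra! h
  refine hs fun v hv => hw ?_
  simp only [Finset.mem_insert, Finset.mem_singleton] at hv
  rcases hv with rfl | rfl
  · exact Finsupp.mem_support_iff.2 h.1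
  · exact Finsupp.mem_support_iff.2 h.2

variable [AddCommGroup E] [Module ℝ E] {K : Geometry.SimplicialComplex ℝ E}

/-- The faces of the stellar subdivision of `K` at an inner point `m` of the edge from `v₀`
to `v₁`. -/
def stellarFaces (K : Geometry.SimplicialComplex ℝ E) (v₀ v₁ m : E) : Set (Finset E) :=
  {s | s.Nonempty ∧ ¬ {v₀, v₁} ⊆ s ∧ carrier v₀ v₁ m s ∈ K.faces}

/-- Distributing the weight at `m` reduces to uniqueness in `K`. The distribution can be undone: as
`v₀` or `v₁` has weight zero, the weight at `m` is the smaller of the distributed weights at `v₀`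
and `v₁` divided by `l₀` and `l₁`. -/
theorem hasUniqueWeights_stellarFaces (hl₀ : 0 < l₀) (hl₁ : 0 < l₁) (hl : l₀ + l₁ = 1)
    (hm : m = l₀ • v₀ + l₁ • v₁) (hne : v₀ ≠ v₁) (hm₀ : m ≠ v₀) (hm₁ : m ≠ v₁) :
    HasUniqueWeights (stellarFaces K v₀ v₁ m) := by
  rintro s ⟨-, hs, hsK⟩ t ⟨-, ht, htK⟩ w w' hw hw' hws hwt hmass hmom
  have heq : distribute v₀ v₁ m l₀ l₁ w = distribute v₀ v₁ m l₀ l₁ w' :=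
    hasUniqueWeights_faces K _ hsK _ htK _ _ (distribute_nonneg hl₀.le hl₁.le hw)
      (distribute_nonneg hl₀.le hl₁.le hw') (support_distribute_subset hws)
      (support_distribute_subset hwt) (by rwa [mass_distribute hl, mass_distribute hl])
      (by rwa [moment_distribute hm, moment_distribute hm])
  have happ := fun v => DFunLike.congr_fun heq v
  simp only [distribute, Finsupp.add_apply, Finsupp.sub_apply, Finsupp.single_apply] at happ
  have h0 := happ v₀
  have h1 := happ v₁
  simp only [hm₀, hm₁, hne, hne.symm, if_true, if_false, sub_zero, add_zero, zero_add] at h0 h1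
  have hw0 : 0 ≤ w v₀ := hw v₀
  have hw1 : 0 ≤ w v₁ := hw v₁
  have hw0' : 0 ≤ w' v₀ := hw' v₀
  have hw1' : 0 ≤ w' v₁ := hw' v₁
  have hwm : w m = w' m := by
    rcases not_both_mem hs hws with h | h <;> rcases not_both_mem ht hwt with h' | h' <;>
      simp only [h, h'] at h0 h1
    · exact mul_left_cancel₀ hl₀.ne' (by linarith)
    -- When different ends have weight zero, the equations at `v₀` and at `v₁` give the two opposite
    -- inequalities.
    · refine le_antisymm ?_ ?_ <;> by_contra! hlt
      · nlinarith
      · nlinarith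
    · refine le_antisymm ?_ ?_ <;> by_contra! hlt
      · nlinarith
      · nlinarith
    · exact mul_left_cancel₀ hl₁.ne' (by linarith)
  ext v
  by_cases hvm : m = v
  · rw [← hvm, hwm]
  · have := happ v
    rw [hwm] at this
    simpa [hvm] using this

/-- The stellar subdivision of `K` at an inner point `m` of the edge from `v₀` to `v₁`. -/
def stellar (K : Geometry.SimplicialComplex ℝ E) {v₀ v₁ m : E} {l₀ l₁ : ℝ} (hl₀ : 0 < l₀)
    (hl₁ : 0 < l₁) (hl : l₀ + l₁ = 1) (hm : m = l₀ • v₀ + l₁ • v₁) (hne : v₀ ≠ v₁) (hm₀ : m ≠ v₀)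
    (hm₁ : m ≠ v₁) : Geometry.SimplicialComplex ℝ E where
  faces := stellarFaces K v₀ v₁ m
  isRelLowerSet_faces := by
    rintro s ⟨hs, hs', hsK⟩
    exact ⟨hs, fun t hts ht => ⟨ht, fun h => hs' (h.trans hts),
      K.down_closed hsK (carrier_mono hts) (carrier_nonempty ht)⟩⟩
  indep hs := (hasUniqueWeights_stellarFaces hl₀ hl₁ hl hm hne hm₀ hm₁).affineIndependent hs
  inter_subset_convexHull hs ht :=
    (hasUniqueWeights_stellarFaces hl₀ hl₁ hl hm hne hm₀ hm₁).inter_subset hs ht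

theorem mem_convexHull_edge (hl₀ : 0 ≤ l₀) (hl₁ : 0 ≤ l₁) (hl : l₀ + l₁ = 1)
    (hm : m = l₀ • v₀ + l₁ • v₁) {s : Finset E} (hs : {v₀, v₁} ⊆ s) :
    m ∈ convexHull ℝ (s : Set E) := by
  rw [hm]
  exact convex_convexHull ℝ _ (subset_convexHull ℝ _ (hs (by simp)))
    (subset_convexHull ℝ _ (hs (by simp))) hl₀ hl₁ hl

/-- A face of `K` contains an inner point of an edge only if it contains the edge. -/
theorem mem_convexHull_iff_edge_subset (hl₀ : 0 < l₀) (hl₁ : 0 < l₁) (hl : l₀ + l₁ = 1)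
    (hm : m = l₀ • v₀ + l₁ • v₁) (hne : v₀ ≠ v₁) (hE : {v₀, v₁} ∈ K.faces) {T F : Finset E}
    (hT : T ∈ K.faces) (hF : F ⊆ T) :
    m ∈ convexHull ℝ (F : Set E) ↔ {v₀, v₁} ⊆ F := by
  refine ⟨fun h => ?_, mem_convexHull_edge hl₀.le hl₁.le hl hm⟩
  obtain ⟨w, hw, hwF, hwm, hwmom⟩ := mem_convexHull_iff_weights.1 h
  have hsupp : (Finsupp.single v₀ l₀ + Finsupp.single v₁ l₁ : E →₀ ℝ).support ⊆ {v₀, v₁} := by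
    refine Finsupp.support_add.trans (Finset.union_subset ?_ ?_)
    · exact Finsupp.support_single_subset.trans (by simp)
    · exact Finsupp.support_single_subset.trans (by simp)
  -- Uniqueness of weights across faces forces the weights of `m` to be `l₀` and `l₁`, both nonzero.
  have heq : w = Finsupp.single v₀ l₀ + Finsupp.single v₁ l₁ :=
    hasUniqueWeights_faces K _ hT _ hE _ _ hw
      (add_nonneg (Finsupp.single_nonneg.2 hl₀.le) (Finsupp.single_nonneg.2 hl₁.le))
      (hwF.trans hF) hsupp (by simp [hwm, hl]) (by simp [hwmom, hm])
  intro v hv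
  apply hwF
  rw [Finsupp.mem_support_iff, heq]
  simp only [Finset.mem_insert, Finset.mem_singleton] at hv
  rcases hv with rfl | rfl
  · simp [hne, hl₀.ne']
  · simp [hne, hl₁.ne']

theorem convexHull_subset_carrier (hl₀ : 0 ≤ l₀) (hl₁ : 0 ≤ l₁) (hl : l₀ + l₁ = 1)
    (hm : m = l₀ • v₀ + l₁ • v₁) (s : Finset E) :
    convexHull ℝ (s : Set E) ⊆ convexHull ℝ (carrier v₀ v₁ m s : Set E) := by
  refine convexHull_min (fun v hv => ?_) (convex_convexHull ℝ _)
  unfold carrier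
  split_ifs with h
  · by_cases hvm : v = m
    · rw [hvm]
      exact mem_convexHull_edge hl₀ hl₁ hl hm Finset.subset_union_right
    · refine subset_convexHull ℝ _ ?_
      have : v ∈ s := hv
      simp [hvm, this]
  · exact subset_convexHull ℝ _ hv

/-- A simplex containing an edge is covered by two of its pieces: here the piece that omits `v₀`. -/
theorem mem_convexHull_insert_erase (hl₀ : 0 < l₀) (hl : l₀ + l₁ = 1)
    (hm : m = l₀ • v₀ + l₁ • v₁) (hne : v₀ ≠ v₁) (hm₀ : m ≠ v₀) (hm₁ : m ≠ v₁) {T : Finset E}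
    {w : E →₀ ℝ} (hw : 0 ≤ w) (hwT : w.support ⊆ T) (hv₁ : v₁ ∈ T)
    (hmass : mass w = 1) (hle : w v₀ * l₁ ≤ w v₁ * l₀) :
    moment w ∈ convexHull ℝ (insert m (T.erase v₀) : Finset E) := by
  -- The weight to move to `m`: taking out `t • (l₀ • v₀ + l₁ • v₁)` exhausts `v₀`, and `hle` keeps
  -- the weight at `v₁` nonnegative.
  set t := w v₀ / l₀ with ht
  have ht0 : t * l₀ = w v₀ := div_mul_cancel₀ _ hl₀.ne'
  have htnn : 0 ≤ t := div_nonneg (hw v₀) hl₀.le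
  have ht1 : t * l₁ ≤ w v₁ := by
    rw [ht, div_mul_eq_mul_div, div_le_iff₀ hl₀]
    exact hle
  let u : E →₀ ℝ := w - (Finsupp.single v₀ (t * l₀) + Finsupp.single v₁ (t * l₁)) +
    Finsupp.single m t
  have hu : ∀ v, u v = w v - ((if v₀ = v then t * l₀ else 0) + (if v₁ = v then t * l₁ else 0)) +
      (if m = v then t else 0) := by
    intro v
    simp only [u, Finsupp.add_apply, Finsupp.sub_apply, Finsupp.single_apply]
  refine mem_convexHull_iff_weights.2 ⟨u, fun v => ?_, fun v hv => ?_, ?_, ?_⟩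
  · rw [hu]
    have := hw v
    simp only [Finsupp.coe_zero, Pi.zero_apply] at this ⊢
    by_cases h0 : v₀ = v
    · subst h0
      simp [hm₀, hne.symm, ht0]
    · by_cases h1 : v₁ = v
      · subst h1
        simp [hm₁, hne, ht1]
      · rw [if_neg h0, if_neg h1]
        split_ifs <;> linarith
  · rw [Finsupp.mem_support_iff, hu] at hv
    by_contra hcon
    apply hv
    simp only [Finset.mem_insert, Finset.mem_erase, not_or, not_and] at hcon
    rw [if_neg (Ne.symm hcon.1)]
    by_cases h0 : v₀ = v
    · subst h0
      simp [hne.symm, ht0]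
    · have hvT := hcon.2 (Ne.symm h0)
      have h1 : v₁ ≠ v := fun h => hvT (h ▸ hv₁)
      simp [h0, h1, Finsupp.notMem_support_iff.1 fun h => hvT (hwT h)]
  · simp only [u, map_add, map_sub, mass_single, hmass]
    linear_combination (-t) * hl
  · simp only [u, map_add, map_sub, moment_single]
    rw [hm, smul_add, mul_smul, mul_smul]
    abel

theorem stellarFaces_finite (hK : K.faces.Finite) : (stellarFaces K v₀ v₁ m).Finite := by
  refine (hK.toFinset.biUnion fun T => (insert m T).powerset).finite_toSet.subset ?_
  rintro s ⟨-, -, hs⟩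
  simp only [Finset.coe_biUnion, Set.mem_iUnion, Finset.mem_coe, Finset.mem_powerset,
    Set.Finite.mem_toFinset]
  refine ⟨_, hs, fun v hv => ?_⟩
  unfold carrier
  grind

/-- The inner points of an edge of a complex are not vertices of the complex. -/
theorem notMem_of_mem_faces (hl₀ : 0 < l₀) (hl₁ : 0 < l₁) (hl : l₀ + l₁ = 1)
    (hm : m = l₀ • v₀ + l₁ • v₁) (hne : v₀ ≠ v₁) (hE : {v₀, v₁} ∈ K.faces) {T : Finset E}
    (hT : T ∈ K.faces) : m ∉ T := by
  intro hmT
  have hsub : {m} ⊆ T := by simpa using hmT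
  have h : ({v₀, v₁} : Finset E) ⊆ {m} := (mem_convexHull_iff_edge_subset hl₀ hl₁ hl hm hne hE hT hsub).1
    (subset_convexHull ℝ _ (by simp))
  have h₀ : v₀ = m := by simpa using h (Finset.mem_insert_self v₀ {v₁})
  have h₁ : v₁ = m := by simpa using h (Finset.mem_insert_of_mem (Finset.mem_singleton_self v₁))
  exact hne (h₀.trans h₁.symm)

theorem space_stellar (hl₀ : 0 < l₀) (hl₁ : 0 < l₁) (hl : l₀ + l₁ = 1)
    (hm : m = l₀ • v₀ + l₁ • v₁) (hne : v₀ ≠ v₁) (hm₀ : m ≠ v₀) (hm₁ : m ≠ v₁)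
    (hE : {v₀, v₁} ∈ K.faces) : (stellar K hl₀ hl₁ hl hm hne hm₀ hm₁).space = K.space := by
  ext x
  rw [Geometry.SimplicialComplex.mem_space_iff, Geometry.SimplicialComplex.mem_space_iff]
  constructor
  · rintro ⟨s, ⟨-, -, hs⟩, hx⟩
    exact ⟨_, hs, convexHull_subset_carrier hl₀.le hl₁.le hl hm s hx⟩
  · rintro ⟨T, hT, hx⟩
    have hmT : m ∉ T := notMem_of_mem_faces hl₀ hl₁ hl hm hne hE hT
    by_cases hET : {v₀, v₁} ⊆ T
    · obtain ⟨w, hw, hwT, hmass, rfl⟩ := mem_convexHull_iff_weights.1 hx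
      have hv₀ : v₀ ∈ T := hET (by simp)
      have hv₁ : v₁ ∈ T := hET (by simp)
      rcases le_total (w v₀ * l₁) (w v₁ * l₀) with hle | hle
      · refine ⟨insert m (T.erase v₀), ⟨by simp, ?_, ?_⟩,
          mem_convexHull_insert_erase hl₀ hl hm hne hm₀ hm₁ hw hwT hv₁ hmass hle⟩
        · grind
        · have : carrier v₀ v₁ m (insert m (T.erase v₀)) = T := by
            unfold carrier
            ext v
            grind
          rwa [this]
      · refine ⟨insert m (T.erase v₁), ⟨by simp, ?_, ?_⟩,
          mem_convexHull_insert_erase hl₁ (by rw [add_comm, hl]) (by rw [hm, add_comm]) hne.symm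
            hm₁ hm₀ hw hwT hv₀ hmass hle⟩
        · grind
        · have : carrier v₀ v₁ m (insert m (T.erase v₁)) = T := by
            unfold carrier
            ext v
            grind
          rwa [this]
    · refine ⟨T, ⟨K.nonempty_of_mem_faces hT, hET, ?_⟩, hx⟩
      simpa [carrier, hmT] using hT

/-- The edges of a stellar subdivision are old ones, or they join the new vertex to a vertex that
is joined to both ends of the subdivided edge. -/
theorem pair_mem_stellarFaces {u w : E} (h : {u, w} ∈ stellarFaces K v₀ v₁ m) :
    {u, w} ∈ K.faces ∨ (u = m ∧ (w = m ∨ ({v₀, w} ∈ K.faces ∧ {v₁, w} ∈ K.faces))) ∨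
      (w = m ∧ {u, v₀} ∈ K.faces ∧ {u, v₁} ∈ K.faces) := by
  obtain ⟨-, -, hK⟩ := h
  have hsub : ∀ a b : E, a ∈ carrier v₀ v₁ m {u, w} → b ∈ carrier v₀ v₁ m {u, w} →
      {a, b} ∈ K.faces := fun a b ha hb =>
    K.down_closed hK (by intro x; simp; rintro (rfl | rfl) <;> assumption) (by simp)
  have hin : ∀ a, a = v₀ ∨ a = v₁ → m ∈ ({u, w} : Finset E) → a ∈ carrier v₀ v₁ m {u, w} := by
    unfold carrier
    grind
  have hother : ∀ a ∈ ({u, w} : Finset E), a ≠ m → a ∈ carrier v₀ v₁ m {u, w} := by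
    unfold carrier
    grind
  by_cases hu : u = m
  · by_cases hw : w = m
    · exact Or.inr (Or.inl ⟨hu, Or.inl hw⟩)
    · exact Or.inr (Or.inl ⟨hu, Or.inr
        ⟨hsub _ _ (hin _ (Or.inl rfl) (by simp [hu])) (hother w (by simp) hw),
          hsub _ _ (hin _ (Or.inr rfl) (by simp [hu])) (hother w (by simp) hw)⟩⟩)
  · by_cases hw : w = m
    · exact Or.inr (Or.inr ⟨hw,
        hsub _ _ (hother u (by simp) hu) (hin _ (Or.inl rfl) (by simp [hw])),
        hsub _ _ (hother u (by simp) hu) (hin _ (Or.inr rfl) (by simp [hw]))⟩)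
    · exact Or.inl (hsub _ _ (hother u (by simp) hu) (hother w (by simp) hw))

end Stellar

/-- A face contains `m` exactly when it contains the edge, so the geometric conditions of a blow-up
become combinatorial. For `s` containing `m`, the old simplex is `carrier v₀ v₁ m s` and its face is
`s.erase m`. -/
theorem isBlowUp_stellar {n : ℕ} {K : Geometry.SimplicialComplex ℝ (Fin n → ℝ)}
    {v₀ v₁ m : Fin n → ℝ} {l₀ l₁ : ℝ} (hl₀ : 0 < l₀) (hl₁ : 0 < l₁) (hl : l₀ + l₁ = 1)
    (hm : m = l₀ • v₀ + l₁ • v₁) (hne : v₀ ≠ v₁) (hm₀ : m ≠ v₀) (hm₁ : m ≠ v₁)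
    (hE : {v₀, v₁} ∈ K.faces) : IsBlowUp K m (stellar K hl₀ hl₁ hl hm hne hm₀ hm₁) := by
  have hmem : ∀ T ∈ K.faces, ∀ F ⊆ T,
      (m ∈ convexHull ℝ (F : Set (Fin n → ℝ)) ↔ {v₀, v₁} ⊆ F) := fun T hT F hF =>
    mem_convexHull_iff_edge_subset hl₀ hl₁ hl hm hne hE hT hF
  have hnot : ∀ T ∈ K.faces, m ∉ T := fun T hT => notMem_of_mem_faces hl₀ hl₁ hl hm hne hE hT
  refine ⟨Geometry.SimplicialComplex.mem_space_iff.2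
    ⟨_, hE, (hmem _ hE _ subset_rfl).2 subset_rfl⟩, fun s => ?_⟩
  constructor
  · rintro ⟨-, hEs, hsK⟩
    by_cases hms : m ∈ s
    · refine Or.inr ⟨_, hsK, ?_, s.erase m, ?_, ?_, ?_⟩
      · rw [hmem _ hsK _ subset_rfl, carrier, if_pos hms]
        exact Finset.subset_union_right
      · rw [carrier, if_pos hms]
        exact Finset.subset_union_left
      · rw [hmem _ hsK _ (by rw [carrier, if_pos hms]; exact Finset.subset_union_left)]
        exact fun h => hEs (h.trans (Finset.erase_subset _ _))
      · rw [← Finset.coe_insert, Finset.insert_erase hms]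
    · rw [carrier, if_neg hms] at hsK
      exact Or.inl ⟨hsK, by rwa [hmem _ hsK _ subset_rfl]⟩
  · rintro (⟨hs, hms⟩ | ⟨T, hT, hmT, F, hFT, hmF, hsF⟩)
    · refine ⟨K.nonempty_of_mem_faces hs, by rwa [← hmem _ hs _ subset_rfl], ?_⟩
      rwa [carrier, if_neg (hnot s hs)]
    · rw [← Finset.coe_insert, Finset.coe_inj] at hsF
      subst hsF
      rw [hmem _ hT _ hFT] at hmF
      rw [hmem _ hT _ subset_rfl] at hmT
      have hmF' : m ∉ F := fun h => hnot T hT (hFT h)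
      refine ⟨by simp, ?_, ?_⟩
      · grind
      · rw [carrier, if_pos (by simp), Finset.erase_insert hmF']
        exact K.down_closed hT (Finset.union_subset hFT hmT) ⟨v₀, by simp⟩

/-! ### Farey mediants -/

theorem homog_injOn {n : ℕ} {v w : Fin n → ℝ} (hv : IsRationalPoint v) (hw : IsRationalPoint w)
    (h : homog v = homog w) : v = w := by
  have hden : den v = den w := by
    have := congrFun h (Fin.last n)
    rw [homog_last, homog_last] at this
    exact_mod_cast this
  ext i
  have := congrArg (fun z : ℤ => (z : ℝ)) (congrFun h i.castSucc)
  simp only [homog_castSucc hv, homog_castSucc hw, hden] at this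
  exact mul_left_cancel₀ (den_pos hw).ne' this

/-- Adding one basis vector to another one gives a basis. -/
theorem exists_basis_add {ι R M : Type*} [CommRing R] [AddCommGroup M] [Module R M]
    (b : Module.Basis ι R M) {i j : ι} (hij : i ≠ j) :
    ∃ b' : Module.Basis ι R M, b' i = b i + b j ∧ ∀ k, k ≠ i → b' k = b k := by
  classical
  have h : b.coord i (b j) = 0 := by simp [hij.symm]
  refine ⟨b.map (LinearEquiv.transvection h), ?_, fun k hk => ?_⟩
  · simp [LinearMap.transvection.apply]
  · simp [LinearMap.transvection.apply, hk]

/-- The Farey mediant of two rational points. -/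
noncomputable def mediant {n : ℕ} (v₀ v₁ : Fin n → ℝ) : Fin n → ℝ :=
  ((den v₀ : ℝ) / (den v₀ + den v₁)) • v₀ + ((den v₁ : ℝ) / (den v₀ + den v₁)) • v₁

theorem mediant_mul {n : ℕ} {v₀ v₁ : Fin n → ℝ} (h₀ : IsRationalPoint v₀)
    (h₁ : IsRationalPoint v₁) (i : Fin n) :
    ((den v₀ + den v₁ : ℕ) : ℝ) * mediant v₀ v₁ i
      = ((homog v₀ i.castSucc + homog v₁ i.castSucc : ℤ) : ℝ) := by
  have := den_pos h₀
  have := den_pos h₁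
  push_cast
  rw [homog_castSucc h₀, homog_castSucc h₁]
  simp only [mediant, Pi.add_apply, Pi.smul_apply, smul_eq_mul]
  field_simp

theorem isRationalPoint_mediant {n : ℕ} {v₀ v₁ : Fin n → ℝ} (h₀ : IsRationalPoint v₀)
    (h₁ : IsRationalPoint v₁) : IsRationalPoint (mediant v₀ v₁) := by
  intro i
  have hpos : (0 : ℝ) < ((den v₀ + den v₁ : ℕ) : ℝ) := by
    push_cast
    exact add_pos (den_pos h₀) (den_pos h₁)
  refine ⟨(homog v₀ i.castSucc + homog v₁ i.castSucc : ℤ) / ((den v₀ + den v₁ : ℕ) : ℚ), ?_⟩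
  rw [Rat.cast_div, Rat.cast_intCast, Rat.cast_natCast, eq_div_iff hpos.ne', mul_comm,
    mediant_mul h₀ h₁]

/-- The sum of the denominators clears those of the mediant. Conversely, `(den v₀ + den v₁) • homog
(mediant v₀ v₁)` is `den (mediant v₀ v₁)` times a basis vector; its coordinate along that vector
shows that the sum divides the denominator. -/
theorem den_mediant {n : ℕ} {v₀ v₁ : Fin n → ℝ} (h₀ : IsRationalPoint v₀)
    (h₁ : IsRationalPoint v₁) {b : Module.Basis (Fin (n + 1)) ℤ (Fin (n + 1) → ℤ)}
    {k : Fin (n + 1)} (hb : b k = homog v₀ + homog v₁) :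
    den (mediant v₀ v₁) = den v₀ + den v₁ := by
  have hrat := isRationalPoint_mediant h₀ h₁
  refine le_antisymm (Nat.sInf_le ⟨Nat.add_pos_left (den_spec h₀).1 _, fun i =>
    ⟨_, mediant_mul h₀ h₁ i⟩⟩) ?_
  have hvec : ((den v₀ + den v₁ : ℕ) : ℤ) • homog (mediant v₀ v₁)
      = (den (mediant v₀ v₁) : ℤ) • b k := by
    rw [hb]
    ext j
    induction j using Fin.lastCases with
    | last =>
      simp only [Pi.smul_apply, Pi.add_apply, homog_last, smul_eq_mul]
      push_cast
      ring
    | cast i =>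
      have h : (((den v₀ + den v₁ : ℕ) : ℤ) : ℝ) * (homog (mediant v₀ v₁) i.castSucc : ℝ)
          = ((den (mediant v₀ v₁) : ℤ) : ℝ) *
            ((homog v₀ i.castSucc + homog v₁ i.castSucc : ℤ) : ℝ) := by
        rw [← mediant_mul h₀ h₁, homog_castSucc hrat]
        push_cast
        ring
      simp only [Pi.smul_apply, Pi.add_apply, smul_eq_mul]
      exact_mod_cast h
  have hcoord := congrArg (b.coord k) hvec
  simp only [map_smul, smul_eq_mul, Module.Basis.coord_apply, Module.Basis.repr_self,
    Finsupp.single_eq_same, mul_one] at hcoord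
  exact Nat.le_of_dvd (den_spec hrat).1 (Int.natCast_dvd_natCast.1 ⟨_, hcoord.symm⟩)

theorem homog_mediant {n : ℕ} {v₀ v₁ : Fin n → ℝ} (h₀ : IsRationalPoint v₀)
    (h₁ : IsRationalPoint v₁) {b : Module.Basis (Fin (n + 1)) ℤ (Fin (n + 1) → ℤ)}
    {k : Fin (n + 1)} (hb : b k = homog v₀ + homog v₁) :
    homog (mediant v₀ v₁) = homog v₀ + homog v₁ := by
  have hden := den_mediant h₀ h₁ hb
  ext j
  induction j using Fin.lastCases with
  | last =>
    simp only [Pi.add_apply, homog_last, hden]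
    push_cast
    ring
  | cast i =>
    have h := homog_castSucc (isRationalPoint_mediant h₀ h₁) i
    rw [hden, mediant_mul h₀ h₁] at h
    exact_mod_cast h

/-- If the homogeneous correspondents of `v₀`, `v₁` and the points of `F` extend to a basis, and
`v₀` is not in `F`, then so do those of the mediant and the points of `F`. -/
theorem exists_basis_mediant {n : ℕ} {v₀ v₁ : Fin n → ℝ} (hne : v₀ ≠ v₁) {F : Finset (Fin n → ℝ)}
    (h : IsRegularSimplex (F ∪ {v₀, v₁})) (hF : v₀ ∉ F) :
    ∃ b : Module.Basis (Fin (n + 1)) ℤ (Fin (n + 1) → ℤ),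
      homog v₀ + homog v₁ ∈ Set.range b ∧ ∀ v ∈ F, homog v ∈ Set.range b := by
  obtain ⟨hrat, b, hb⟩ := h
  have hr₀ := hrat v₀ (by simp)
  obtain ⟨i, hi⟩ := hb v₀ (by simp)
  obtain ⟨j, hj⟩ := hb v₁ (by simp)
  have hij : i ≠ j := by
    rintro rfl
    exact hne (homog_injOn hr₀ (hrat v₁ (by simp)) (hi.symm.trans hj))
  -- Only the basis vector of `v₀` changes, and no point of `F` uses it.
  obtain ⟨b', hbi, hb'⟩ := exists_basis_add b hij
  refine ⟨b', ⟨i, by rw [hbi, hi, hj]⟩, fun v hv => ?_⟩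
  obtain ⟨k, hk⟩ := hb v (by simp [hv])
  refine ⟨k, ?_⟩
  rw [hb' k, hk]
  rintro rfl
  exact hF (homog_injOn hr₀ (hrat v (by simp [hv])) (hi.symm.trans hk) ▸ hv)

theorem homog_mediant_of_regular {n : ℕ} {v₀ v₁ : Fin n → ℝ} (hne : v₀ ≠ v₁)
    (h : IsRegularSimplex {v₀, v₁}) : homog (mediant v₀ v₁) = homog v₀ + homog v₁ := by
  obtain ⟨b, ⟨k, hk⟩, -⟩ := exists_basis_mediant (F := ∅) hne (by simpa using h) (by simp)
  exact homog_mediant (h.1 v₀ (by simp)) (h.1 v₁ (by simp)) hk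

/-- `F` misses one end of the edge, and the basis vector of that end can be traded for the sum. -/
theorem isRegularSimplex_insert_mediant {n : ℕ} {v₀ v₁ : Fin n → ℝ} (hne : v₀ ≠ v₁)
    {F : Finset (Fin n → ℝ)} (h : IsRegularSimplex (F ∪ {v₀, v₁})) (hF : ¬ {v₀, v₁} ⊆ F) :
    IsRegularSimplex (insert (mediant v₀ v₁) F) := by
  have hrat := h.1
  have hr₀ := hrat v₀ (by simp)
  have hr₁ := hrat v₁ (by simp)
  have hb : ∃ b : Module.Basis (Fin (n + 1)) ℤ (Fin (n + 1) → ℤ),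
      homog v₀ + homog v₁ ∈ Set.range b ∧ ∀ v ∈ F, homog v ∈ Set.range b := by
    by_cases h0 : v₀ ∈ F
    · have h1 : v₁ ∉ F := by grind
      rw [add_comm (homog v₀)]
      exact exists_basis_mediant hne.symm (by rwa [Finset.pair_comm]) h1
    · exact exists_basis_mediant hne h h0
  obtain ⟨b, ⟨k, hk⟩, hbF⟩ := hb
  refine ⟨fun v hv => ?_, b, fun v hv => ?_⟩
  · rcases Finset.mem_insert.1 hv with rfl | hv
    · exact isRationalPoint_mediant hr₀ hr₁
    · exact hrat v (by simp [hv])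
  · rcases Finset.mem_insert.1 hv with rfl | hv
    · exact ⟨k, by rw [hk, homog_mediant hr₀ hr₁ hk]⟩
    · exact hbF v hv

/-! ### Binary Farey blow-ups exist -/

theorem exists_binaryFareyBlowUp {n : ℕ} {K : Geometry.SimplicialComplex ℝ (Fin n → ℝ)}
    (hK : IsRegularComplex K) {v₀ v₁ : Fin n → ℝ} (hne : v₀ ≠ v₁) (hE : {v₀, v₁} ∈ K.faces) :
    ∃ K' : Geometry.SimplicialComplex ℝ (Fin n → ℝ), IsBinaryFareyBlowUp K K' ∧
      IsRegularComplex K' ∧ IsSubdivision K' K ∧ {v₀, v₁} ∉ K'.faces ∧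
      ∃ m, homog m = homog v₀ + homog v₁ ∧ ∀ u w, {u, w} ∈ K'.faces →
        {u, w} ∈ K.faces ∨ (u = m ∧ (w = m ∨ ({v₀, w} ∈ K.faces ∧ {v₁, w} ∈ K.faces))) ∨
          (w = m ∧ {u, v₀} ∈ K.faces ∧ {u, v₁} ∈ K.faces) := by
  have hreg := hK.2 _ hE
  have hr₀ := hreg.1 v₀ (by simp)
  have hr₁ := hreg.1 v₁ (by simp)
  have hd₀ := den_pos hr₀
  have hd₁ := den_pos hr₁
  have hhom := homog_mediant_of_regular hne hreg
  have hl₀ : 0 < (den v₀ : ℝ) / (den v₀ + den v₁) := by positivity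
  have hl₁ : 0 < (den v₁ : ℝ) / (den v₀ + den v₁) := by positivity
  have hl : (den v₀ : ℝ) / (den v₀ + den v₁) + (den v₁ : ℝ) / (den v₀ + den v₁) = 1 := by
    field_simp
  have hden : (den (mediant v₀ v₁) : ℤ) = den v₀ + den v₁ := by
    have := congrFun hhom (Fin.last n)
    simpa only [Pi.add_apply, homog_last] using this
  have hm₀ : mediant v₀ v₁ ≠ v₀ := fun h => by
    rw [h] at hden
    have := (den_spec hr₁).1
    omega
  have hm₁ : mediant v₀ v₁ ≠ v₁ := fun h => by
    rw [h] at hden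
    have := (den_spec hr₀).1
    omega
  have hm : mediant v₀ v₁ = ((den v₀ : ℝ) / (den v₀ + den v₁)) • v₀ +
    ((den v₁ : ℝ) / (den v₀ + den v₁)) • v₁ := rfl
  have hblow := isBlowUp_stellar (K := K) hl₀ hl₁ hl hm hne hm₀ hm₁ hE
  refine ⟨stellar K hl₀ hl₁ hl hm hne hm₀ hm₁,
    ⟨hK, v₀, v₁, _, hne, ⟨_, hE, by simp⟩,
      ⟨?_, isRationalPoint_mediant hr₀ hr₁, hhom⟩, hblow⟩,
    ⟨stellarFaces_finite hK.1, ?_⟩, ⟨space_stellar hl₀ hl₁ hl hm hne hm₀ hm₁ hE, ?_⟩,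
    fun h => h.2.1 subset_rfl, _, hhom, fun u w h => pair_mem_stellarFaces h⟩
  · have := mem_convexHull_edge (m := mediant v₀ v₁) hl₀.le hl₁.le hl hm
      (subset_refl ({v₀, v₁} : Finset (Fin n → ℝ)))
    simpa using this
  · rintro s ⟨-, hEs, hs⟩
    by_cases hms : mediant v₀ v₁ ∈ s
    · rw [carrier, if_pos hms] at hs
      have := isRegularSimplex_insert_mediant hne (hK.2 _ hs)
        fun h => hEs (h.trans (Finset.erase_subset _ _))
      rwa [Finset.insert_erase hms] at this
    · rw [carrier, if_neg hms] at hs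
      exact hK.2 _ hs
  · rintro s ⟨-, -, hs⟩
    exact ⟨_, hs, convexHull_subset_carrier hl₀.le hl₁.le hl hm s⟩

/-! ### Making a linear form of constant sign on every simplex -/

/-- No edge of `K` joins a vertex where the form `a` is positive to one where it is negative. -/
def IsSignCoherent {n : ℕ} (a : Fin (n + 1) → ℤ)
    (K : Geometry.SimplicialComplex ℝ (Fin n → ℝ)) : Prop :=
  ∀ u w, {u, w} ∈ K.faces → 0 < homogForm a u → 0 ≤ homogForm a w

/-- `K'` arises from `K` by binary Farey blow-ups, and it inherits all that is needed below. -/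
structure FareyRefines {n : ℕ} (K K' : Geometry.SimplicialComplex ℝ (Fin n → ℝ)) : Prop where
  blowUps : Relation.ReflTransGen IsBinaryFareyBlowUp K K'
  regular : IsRegularComplex K'
  subdivision : IsSubdivision K' K
  coherent : ∀ a, IsSignCoherent a K → IsSignCoherent a K'

theorem FareyRefines.refl {n : ℕ} {K : Geometry.SimplicialComplex ℝ (Fin n → ℝ)}
    (hK : IsRegularComplex K) : FareyRefines K K :=
  ⟨.refl, hK, ⟨rfl, fun s hs => ⟨s, hs, subset_rfl⟩⟩, fun _ h => h⟩

theorem FareyRefines.trans {n : ℕ} {K L M : Geometry.SimplicialComplex ℝ (Fin n → ℝ)}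
    (h : FareyRefines K L) (h' : FareyRefines L M) : FareyRefines K M := by
  refine ⟨h.blowUps.trans h'.blowUps, h'.regular,
    ⟨h'.subdivision.1.trans h.subdivision.1, fun s hs => ?_⟩,
    fun a ha => h'.coherent a (h.coherent a ha)⟩
  obtain ⟨t, ht, hst⟩ := h'.subdivision.2 s hs
  obtain ⟨r, hr, htr⟩ := h.subdivision.2 t ht
  exact ⟨r, hr, hst.trans htr⟩

theorem homogForm_add {n : ℕ} (a : Fin (n + 1) → ℤ) {v₀ v₁ m : Fin n → ℝ}
    (h : homog m = homog v₀ + homog v₁) : homogForm a m = homogForm a v₀ + homogForm a v₁ := by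
  simp only [homogForm, h, Pi.add_apply, mul_add, Finset.sum_add_distrib]

/-- Coherence persists because a neighbour `w ≠ m` of the new vertex `m` was adjacent to both ends.
If the form is positive at `m`, it is positive at some end, hence nonnegative at `w`; if it is
positive at `w`, it is nonnegative at both ends, hence at `m`. -/
theorem exists_fareyRefines_edge {n : ℕ} {K : Geometry.SimplicialComplex ℝ (Fin n → ℝ)}
    (hK : IsRegularComplex K) {v₀ v₁ : Fin n → ℝ} (hne : v₀ ≠ v₁) (hE : {v₀, v₁} ∈ K.faces) :
    ∃ K' : Geometry.SimplicialComplex ℝ (Fin n → ℝ), FareyRefines K K' ∧ {v₀, v₁} ∉ K'.faces ∧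
      ∃ m, homog m = homog v₀ + homog v₁ ∧ ∀ u w, {u, w} ∈ K'.faces →
        {u, w} ∈ K.faces ∨ (u = m ∧ (w = m ∨ ({v₀, w} ∈ K.faces ∧ {v₁, w} ∈ K.faces))) ∨
          (w = m ∧ {u, v₀} ∈ K.faces ∧ {u, v₁} ∈ K.faces) := by
  obtain ⟨K', hblow, hreg, hsub, hnot, m, hm, hedge⟩ := exists_binaryFareyBlowUp hK hne hE
  refine ⟨K', ⟨.single hblow, hreg, hsub, fun a ha u w huw hu => ?_⟩, hnot, m, hm, hedge⟩
  have hma := homogForm_add a hm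
  rcases hedge u w huw with h | ⟨rfl, rfl | ⟨h₀, h₁⟩⟩ | ⟨rfl, h₀, h₁⟩
  · exact ha u w h hu
  · exact hu.le
  · by_cases hv : 0 < homogForm a v₀
    · exact ha _ _ h₀ hv
    · exact ha _ _ h₁ (by omega)
  · have := ha _ _ h₀ hu
    have := ha _ _ h₁ hu
    omega

/-- The pairs of adjacent vertices where the form `a` has opposite signs, the larger of the two
absolute values being `M`. -/
def badEdges {n : ℕ} (a : Fin (n + 1) → ℤ) (K : Geometry.SimplicialComplex ℝ (Fin n → ℝ)) (M : ℤ) :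
    Set ((Fin n → ℝ) × (Fin n → ℝ)) :=
  {p | {p.1, p.2} ∈ K.faces ∧ 0 < homogForm a p.1 ∧ homogForm a p.2 < 0 ∧
    max (homogForm a p.1) (-homogForm a p.2) = M}

theorem badEdges_finite {n : ℕ} (a : Fin (n + 1) → ℤ)
    {K : Geometry.SimplicialComplex ℝ (Fin n → ℝ)} (hK : K.faces.Finite) (M : ℤ) :
    (badEdges a K M).Finite := by
  refine (hK.toFinset.biUnion fun T => T ×ˢ T).finite_toSet.subset fun p hp => ?_
  simp only [Finset.coe_biUnion, Set.mem_iUnion, Finset.mem_coe, Set.Finite.mem_toFinset]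
  exact ⟨_, hp.1, by simp⟩

/-- Blowing up a bad edge whose pair of absolute values is lexicographically maximal removes it
and creates no bad edge of the same size. -/
theorem exists_fareyRefines_ssubset {n : ℕ} (a : Fin (n + 1) → ℤ)
    {K : Geometry.SimplicialComplex ℝ (Fin n → ℝ)} (hK : IsRegularComplex K) {M : ℤ}
    (hM : ∀ N, M < N → badEdges a K N = ∅) (hne : (badEdges a K M).Nonempty) :
    ∃ K', FareyRefines K K' ∧ (∀ N, M < N → badEdges a K' N = ∅) ∧
      badEdges a K' M ⊂ badEdges a K M := by
  have hbound : ∀ u w, {u, w} ∈ K.faces → 0 < homogForm a u → homogForm a w < 0 →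
      homogForm a u ≤ M ∧ -homogForm a w ≤ M := by
    intro u w huw hu hw
    by_contra hcon
    have hlt : M < max (homogForm a u) (-homogForm a w) := by
      rw [lt_max_iff]
      omega
    have hmem : (u, w) ∈ badEdges a K (max (homogForm a u) (-homogForm a w)) := ⟨huw, hu, hw, rfl⟩
    rw [hM _ hlt] at hmem
    exact hmem
  -- An edge with values `M` and `-M` is preferred, its mediant having value `0`. If there is none,
  -- any bad edge of size `M` will do.
  obtain ⟨v₀, v₁, hE, hpos, hneg, hmax, hchoice⟩ : ∃ v₀ v₁, {v₀, v₁} ∈ K.faces ∧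
      0 < homogForm a v₀ ∧ homogForm a v₁ < 0 ∧
      max (homogForm a v₀) (-homogForm a v₁) = M ∧
      (homogForm a v₀ + homogForm a v₁ = 0 ∨ ∀ u w, {u, w} ∈ K.faces →
        homogForm a u = M → -homogForm a w = M → False) := by
    by_cases h : ∃ u w, {u, w} ∈ K.faces ∧ homogForm a u = M ∧ -homogForm a w = M
    · obtain ⟨u, w, huw, hu, hw⟩ := h
      obtain ⟨p, -, hp, -, hpM⟩ := hne
      have hMpos : 0 < M := hpM ▸ lt_max_of_lt_left hp
      exact ⟨u, w, huw, by omega, by omega, by rw [hu, hw, max_self], Or.inl (by omega)⟩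
    · obtain ⟨p, hp⟩ := hne
      exact ⟨p.1, p.2, hp.1, hp.2.1, hp.2.2.1, hp.2.2.2, Or.inr fun u w h1 h2 h3 =>
        h ⟨u, w, h1, h2, h3⟩⟩
  have hv : v₀ ≠ v₁ := by
    rintro rfl
    omega
  obtain ⟨K', hK', hnot, m, hm, hedge⟩ := exists_fareyRefines_edge hK hv hE
  have hma := homogForm_add a hm
  obtain ⟨hb₀, hb₁⟩ := hbound _ _ hE hpos hneg
  have hmax' : homogForm a v₀ = M ∨ -homogForm a v₁ = M := by
    rcases max_choice (homogForm a v₀) (-homogForm a v₁) with h | h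
    · exact Or.inl (h ▸ hmax)
    · exact Or.inr (h ▸ hmax)
  -- The value at `m` lies strictly between `-M` and `M`. A new bad edge of size `M` would thus have
  -- its extreme value at the old vertex. The end with the sign of `m` is then the one of absolute
  -- value `M`, and it was joined to that old vertex by an edge with values `M` and `-M`, against
  -- the choice.
  have hnew : ∀ u w, {u, w} ∈ K'.faces → 0 < homogForm a u → homogForm a w < 0 →
      {u, w} ∈ K.faces ∨ max (homogForm a u) (-homogForm a w) < M := by
    intro u w huw hu hw
    rcases hedge u w huw with h | ⟨rfl, rfl | ⟨h₀, -⟩⟩ | ⟨rfl, -, h₁⟩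
    · exact Or.inl h
    · omega
    · refine Or.inr (max_lt (by omega) ?_)
      obtain ⟨-, hw'⟩ := hbound _ _ h₀ hpos hw
      refine lt_of_le_of_ne hw' fun hwM => ?_
      rcases hchoice with h | h
      · omega
      · exact h _ _ h₀ (by omega) hwM
    · refine Or.inr (max_lt ?_ (by omega))
      obtain ⟨hu', -⟩ := hbound _ _ h₁ hu hneg
      refine lt_of_le_of_ne hu' fun huM => ?_
      rcases hchoice with h | h
      · omega
      · exact h _ _ h₁ huM (by omega)
  have hsub : ∀ N, M ≤ N → badEdges a K' N ⊆ badEdges a K N := by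
    rintro N hN ⟨u, w⟩ ⟨huw, hu, hw, hmx⟩
    rcases hnew u w huw hu hw with h | h
    · exact ⟨h, hu, hw, hmx⟩
    · exact absurd hmx (h.trans_le hN).ne
  refine ⟨K', hK', fun N hN => Set.subset_empty_iff.1 (hM N hN ▸ hsub N hN.le),
    (Set.ssubset_iff_of_subset (hsub M le_rfl)).2 ⟨(v₀, v₁), ⟨hE, hpos, hneg, hmax⟩, ?_⟩⟩
  exact fun h => hnot h.1

/-- Double induction: on a bound for the size of bad edges, and, within it, on the number of bad
edges of maximal size. Smaller bad edges may multiply meanwhile, which does no harm. -/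
theorem exists_fareyRefines_coherent_of_bound {n : ℕ} (a : Fin (n + 1) → ℤ) (M : ℕ) :
    ∀ K : Geometry.SimplicialComplex ℝ (Fin n → ℝ), IsRegularComplex K →
      (∀ N : ℤ, M < N → badEdges a K N = ∅) → ∃ K', FareyRefines K K' ∧ IsSignCoherent a K' := by
  induction M with
  | zero =>
    intro K hK hM
    refine ⟨K, .refl hK, fun u w huw hu => ?_⟩
    by_contra! hw
    have hmem : (u, w) ∈ badEdges a K _ := ⟨huw, hu, hw, rfl⟩
    rw [hM _ (by exact_mod_cast lt_max_of_lt_left hu)] at hmem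
    exact hmem
  | succ M ih =>
    intro K hK hM
    induction hc : (badEdges a K (M + 1 : ℕ)).ncard using Nat.strong_induction_on generalizing K with
    | _ c ihc =>
      rcases (badEdges a K (M + 1 : ℕ)).eq_empty_or_nonempty with hempty | hne
      · refine ih K hK fun N hN => ?_
        rcases eq_or_ne N (M + 1 : ℕ) with rfl | hN'
        · exact hempty
        · exact hM N (by push_cast at hN' ⊢; omega)
      · obtain ⟨L, hL, hLM, hss⟩ := exists_fareyRefines_ssubset a hK hM hne
        obtain ⟨K', hK', hcoh⟩ := ihc _
          (hc ▸ Set.ncard_lt_ncard hss (badEdges_finite a hK.1 _)) L hL.regular hLM rfl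
        exact ⟨K', hL.trans hK', hcoh⟩

theorem exists_fareyRefines_coherent {n : ℕ} (a : Fin (n + 1) → ℤ)
    {K : Geometry.SimplicialComplex ℝ (Fin n → ℝ)} (hK : IsRegularComplex K) :
    ∃ K', FareyRefines K K' ∧ IsSignCoherent a K' := by
  let V : Finset (Fin n → ℝ) := hK.1.toFinset.biUnion id
  -- Any bound for the absolute values at the vertices would do; the sum avoids a maximum over a
  -- possibly empty set.
  refine exists_fareyRefines_coherent_of_bound a (∑ v ∈ V, (homogForm a v).natAbs) K hK
    fun N hN => Set.eq_empty_iff_forall_notMem.2 ?_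
  rintro ⟨u, w⟩ ⟨huw, -, -, rfl⟩
  have hle : ∀ v ∈ ({u, w} : Finset (Fin n → ℝ)),
      (homogForm a v).natAbs ≤ ∑ v ∈ V, (homogForm a v).natAbs := fun v hv =>
    Finset.single_le_sum (f := fun v => (homogForm a v).natAbs) (fun _ _ => Nat.zero_le _)
      (Finset.mem_biUnion.2 ⟨_, hK.1.mem_toFinset.2 huw, hv⟩)
  have hu := hle u (by simp)
  have hw := hle w (by simp)
  simp only at hN
  rcases lt_max_iff.1 hN with h | h <;> omega

theorem exists_fareyRefines_coherent_of_finite {n : ℕ} {A : Set (Fin (n + 1) → ℤ)} (hA : A.Finite)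
    {K : Geometry.SimplicialComplex ℝ (Fin n → ℝ)} (hK : IsRegularComplex K) :
    ∃ K', FareyRefines K K' ∧ ∀ a ∈ A, IsSignCoherent a K' := by
  induction A, hA using Set.Finite.induction_on with
  | empty => exact ⟨K, .refl hK, by simp⟩
  | @insert a A _ _ ih =>
    obtain ⟨L, hL, hLA⟩ := ih
    obtain ⟨K', hK', ha⟩ := exists_fareyRefines_coherent a hL.regular
    refine ⟨K', hL.trans hK', fun b hb => ?_⟩
    rcases hb with rfl | hb
    · exact ha
    · exact hK'.coherent b (hLA b hb)

/-! ### Polytopes as unions of simplexes -/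

/-- If the forms that define a polytope are of constant sign on every simplex of `K`, then every
point of the polytope in the support of `K` lies in a simplex of `K` inside the polytope. -/
theorem exists_face_subset_of_coherent {n : ℕ} {K : Geometry.SimplicialComplex ℝ (Fin n → ℝ)}
    (hK : IsRegularComplex K) {S : Set (Fin n → ℝ)} (hS : Convex ℝ S) {A : Set (Fin (n + 1) → ℤ)}
    (hA : ∀ x, x ∈ S ↔ ∀ a ∈ A, 0 ≤ affineForm a x) (hcoh : ∀ a ∈ A, IsSignCoherent a K)
    {x : Fin n → ℝ} (hxS : x ∈ S) (hxK : x ∈ K.space) :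
    ∃ T ∈ K.faces, x ∈ convexHull ℝ (T : Set (Fin n → ℝ)) ∧
      convexHull ℝ (T : Set (Fin n → ℝ)) ⊆ S := by
  obtain ⟨s, hs, hxs⟩ := Geometry.SimplicialComplex.mem_space_iff.1 hxK
  obtain ⟨w, hw, hws, hmass, rfl⟩ := mem_convexHull_iff_weights.1 hxs
  have hne : w.support.Nonempty := by
    rw [Finsupp.support_nonempty_iff]
    rintro rfl
    simp at hmass
  -- Passing to the support makes all weights positive, so a single negative vertex, the others
  -- being nonpositive by coherence, would make the form negative at the point.
  have hT : w.support ∈ K.faces := K.down_closed hs hws hne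
  refine ⟨w.support, hT, mem_convexHull_iff_weights.2 ⟨w, hw, subset_rfl, hmass, rfl⟩,
    convexHull_min (fun v hv => (hA v).2 fun a ha => ?_) hS⟩
  have hrat := (hK.2 _ hT).1
  by_contra! hlt
  have hneg : ∀ u ∈ w.support, affineForm a u ≤ 0 := by
    intro u hu
    by_contra! hpos
    have h1 : (0 : ℝ) < homogForm a u := by
      rw [homogForm_eq a (hrat u hu)]
      exact mul_pos (den_pos (hrat u hu)) hpos
    have h2 : (homogForm a v : ℝ) < 0 := by
      rw [homogForm_eq a (hrat v hv)]
      exact mul_neg_of_pos_of_neg (den_pos (hrat v hv)) hlt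
    have h3 := hcoh a ha u v (K.down_closed hT (Finset.insert_subset hu
      (Finset.singleton_subset_iff.2 hv)) (by simp)) (by exact_mod_cast h1)
    exact absurd (by exact_mod_cast h2) h3.not_gt
  have hx := (hA _).1 hxS a ha
  rw [mass_eq_sum subset_rfl] at hmass
  rw [moment_eq_sum subset_rfl, affineForm_sum a _ _ hmass] at hx
  refine absurd hx (not_le.2 (Finset.sum_neg' (fun u hu =>
    mul_nonpos_of_nonneg_of_nonpos (hw u) (hneg u hu)) ⟨v, hv, mul_neg_of_pos_of_neg ?_ hlt⟩))
  exact lt_of_le_of_ne (hw v) (Ne.symm (Finsupp.mem_support_iff.1 hv))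

end FareyComplex

theorem proposition2p5 {n : ℕ} (P Q : Set (Fin n → ℝ))
    (hP : FareyComplex.IsRationalPolyhedron P) (hQ : FareyComplex.IsRationalPolyhedron Q)
    (hQP : Q ⊆ P) (hcube : P ⊆ Set.Icc 0 1)
    (Δ : Geometry.SimplicialComplex ℝ (Fin n → ℝ)) (hΔ : FareyComplex.IsRegularComplex Δ)
    (hsupp : Δ.space = P) :
    ∃ Δ' : Geometry.SimplicialComplex ℝ (Fin n → ℝ),
      Relation.ReflTransGen FareyComplex.IsBinaryFareyBlowUp Δ Δ' ∧
      FareyComplex.IsRegularComplex Δ' ∧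
      FareyComplex.IsSubdivision Δ' Δ ∧
      Q = ⋃ T ∈ {T | T ∈ Δ'.faces ∧ convexHull ℝ (T : Set (Fin n → ℝ)) ⊆ Q},
        convexHull ℝ (T : Set (Fin n → ℝ)) := by
  obtain ⟨𝓕, h𝓕, hQ𝓕⟩ := hQ
  choose! A hAfin hA using fun S hS => FareyComplex.exists_forms_convexHull S (h𝓕 S hS)
  -- One refinement serves the forms of all the polytopes of `Q` at once.
  obtain ⟨Δ', hΔ', hcoh⟩ := FareyComplex.exists_fareyRefines_coherent_of_finite
    (𝓕.finite_toSet.biUnion hAfin) hΔ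
  refine ⟨Δ', hΔ'.blowUps, hΔ'.regular, hΔ'.subdivision, subset_antisymm (fun x hx => ?_)
    (Set.iUnion₂_subset fun T hT => hT.2)⟩
  have hxK : x ∈ Δ'.space := by
    rw [hΔ'.subdivision.1, hsupp]
    exact hQP hx
  have hx' := hx
  rw [hQ𝓕] at hx'
  obtain ⟨S, hS, hxS⟩ := Set.mem_iUnion₂.1 hx'
  obtain ⟨T, hT, hxT, hTS⟩ := FareyComplex.exists_face_subset_of_coherent hΔ'.regular
    (convex_convexHull ℝ _) (hA S hS) (fun a ha => hcoh a (Set.mem_biUnion hS ha)) hxS hxK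
  refine Set.mem_iUnion₂.2 ⟨T, ⟨hT, hTS.trans ?_⟩, hxT⟩
  rw [hQ𝓕]
  exact Set.subset_biUnion_of_mem (u := fun s : Finset (Fin n → ℝ) =>
    convexHull ℝ (s : Set (Fin n → ℝ))) hS
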